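/- Let $S$ be a monoid acting on a group $G$ by injective endomorphisms, $\sigma\colon S\to \mathrm{End}(G)$, $s\mapsto\sigma_s$, and suppose that the action is non-automorphic, i.e. $\sigma_s$ is not surjective for some $s\in S$. Let $I_\sigma$ be the inverse semigroup of partial bijections of $G$ generated by the maps $\sigma_s$ ($s\in S$) and the left translations $h\mapsto gh$ ($g\in G$). Let $\mathcal E$ be its semilattice of idempotents, each idempotent being identified with its domain (a subset of $G$), and let $\widehat{\mathcal E}$ be the space of characters of $\mathcal E$, i.e. of non-zero multiplicative maps $\chi\colon\mathcal E\to\{0,1\}$ with $\chi(\emptyset)=0$, with the topology of pointwise convergence. Let $\partial\widehat{\mathcal E}$ be the closure in $\widehat{\mathcal E}$ of the set of characters $\chi$ for which the filter $\{A\in\mathcal E : \chi(A)=1\}$ is maximal with respect to inclusion. Let $\mathcal G_\sigma=I_\sigma\ltimes\partial\widehat{\mathcal E}$ be the tight groupoid: its arrows are the germs $[\phi,\chi]$ with $\phi\in I_\sigma$, $\chi\in\partial\widehat{\mathcal E}$, $\chi(\mathrm{dom}\,\phi)=1$ and $\phi.\chi:=\chi(\phi^{-1}\,\cdot\,\phi)\in\partial\widehat{\mathcal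 E}$, where $[\phi,\chi]=[\psi,\chi]$ if and only if $\phi|_A=\psi|_A$ for some $A\in\mathcal E$ with $\chi(A)=1$. The source and range of $[\phi,\chi]$ are $\chi$ and $\phi.\chi$, the product is $[\phi,\psi.\chi][\psi,\chi]=[\phi\psi,\chi]$, and the topology is generated by the sets $\{[\phi,\chi] : \chi\in W\}$, where $\phi\in I_\sigma$ and $W=\{\chi\in\partial\widehat{\mathcal E} : \chi(A)=1,\ \chi(A_i)=0 \text{ for } 1\le i\le n\}$, with $A,A_1,\dots,A_n\in\mathcal E$ and $n\ge 0$, is such that $\chi(\mathrm{dom}\,\phi)=1$ for all $\chi\in W$. If $\mathcal G_\sigma$ is minimal (every orbit is dense in the unit space $\partial\widehat{\mathcal E}$), then $\mathcal G_\sigma$ is purely infinite: for every compact open set $X\subseteq\partial\widehat{\mathcal E}$ there are compact open bisections $U,V\subseteq\mathcal G_\sigma$ such that $s(U)=s(V)=X$, and $r(U)$, $r(V)$ are disjoint subsets of $X$. -/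

import Mathlib

open CategoryTheory

universe u v

/-! ### Topological groupoids: minimality and pure infiniteness

A groupoid is a category-theoretic groupoid `X`: the type `X` of objects is the unit space, and
`Arrow X` is the set of all its arrows, with source `a.left` and range `a.right`. -/

namespace GroupoidDynamics

section

variable {X : Type u} [Groupoid.{v} X]

/-- A set of arrows is a bisection if the source and the range maps are injective on it. -/
def IsBisection (U : Set (Arrow X)) : Prop :=
  Set.InjOn (fun a : Arrow X => a.left) U ∧ Set.InjOn (fun a : Arrow X => a.right) U

/-- The image of a set of arrows under the source map. -/
def sourceSet (U : Set (Arrow X)) : Set X := (fun a : Arrow X => a.left) '' U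

/-- The image of a set of arrows under the range map. -/
def rangeSet (U : Set (Arrow X)) : Set X := (fun a : Arrow X => a.right) '' U

/-- The orbit of a unit. -/
def orbit (x : X) : Set X := {y | Nonempty (x ⟶ y)}

variable (X) in
/-- A groupoid is minimal if every orbit is dense in the unit space. -/
def IsMinimal [TopologicalSpace X] : Prop := ∀ x : X, Dense (orbit x)

variable [TopologicalSpace (Arrow X)]

/-- Compact open bisections. -/
def IsCompactOpenBisection (U : Set (Arrow X)) : Prop :=
  IsCompact U ∧ IsOpen U ∧ IsBisection U

/-- A set `A` of units is properly infinite if there are compact open bisections `U`, `V` with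
`s(U) = s(V) = A` such that `r(U)` and `r(V)` are disjoint subsets of `A`. -/
def IsProperlyInfinite (A : Set X) : Prop :=
  ∃ U V : Set (Arrow X), IsCompactOpenBisection U ∧ IsCompactOpenBisection V ∧
    sourceSet U = A ∧ sourceSet V = A ∧
    Disjoint (rangeSet U) (rangeSet V) ∧ rangeSet U ⊆ A ∧ rangeSet V ⊆ A

variable (X) in
/-- A groupoid is purely infinite if every compact open set of units is properly infinite. -/
def IsPurelyInfinite [TopologicalSpace X] : Prop :=
  ∀ A : Set X, IsCompact A → IsOpen A → IsProperlyInfinite A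

end

end GroupoidDynamics

/-! ### Partial bijections -/

namespace PEquiv

variable {α : Type u}

/-- The domain of a partial bijection. -/
def dom (φ : α ≃. α) : Set α := {a | ∃ b, b ∈ φ a}

/-- The preimage of a set under a partial bijection. -/
def preim (φ : α ≃. α) (A : Set α) : Set α := {a | ∃ b, b ∈ φ a ∧ b ∈ A}

/-- Two partial bijections have the same restriction to the set `A`. -/
def AgreeOn (φ ψ : α ≃. α) (A : Set α) : Prop := ∀ a ∈ A, φ a = ψ a

theorem mem_dom {φ : α ≃. α} {a : α} : a ∈ φ.dom ↔ ∃ b, b ∈ φ a := Iff.rfl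

theorem dom_trans (φ ψ : α ≃. α) : (φ.trans ψ).dom = φ.preim ψ.dom := by
  ext a
  simp only [dom, preim, Set.mem_ofPred_eq, mem_trans]
  constructor
  · rintro ⟨c, b, hb, hc⟩
    exact ⟨b, hb, c, hc⟩
  · rintro ⟨b, hb, c, hc⟩
    exact ⟨c, b, hb, hc⟩

theorem preim_refl (A : Set α) : (PEquiv.refl α).preim A = A := by
  ext a
  simp [preim]

theorem dom_refl : (PEquiv.refl α).dom = Set.univ := by
  ext a
  simp [dom]

theorem preim_trans (φ ψ : α ≃. α) (A : Set α) :
    (φ.trans ψ).preim A = φ.preim (ψ.preim A) := by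
  ext a
  simp only [preim, Set.mem_ofPred_eq, mem_trans]
  constructor
  · rintro ⟨c, ⟨b, hb, hc⟩, hA⟩
    exact ⟨b, hb, c, hc, hA⟩
  · rintro ⟨b, hb, c, hc, hA⟩
    exact ⟨c, ⟨b, hb, hc⟩, hA⟩

theorem preim_inter (φ : α ≃. α) (A B : Set α) :
    φ.preim (A ∩ B) = φ.preim A ∩ φ.preim B := by
  ext a
  simp only [preim, Set.mem_ofPred_eq, Set.mem_inter_iff]
  constructor
  · rintro ⟨b, hb, hA, hB⟩
    exact ⟨⟨b, hb, hA⟩, ⟨b, hb, hB⟩⟩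
  · rintro ⟨⟨b, hb, hA⟩, ⟨c, hc, hB⟩⟩
    have : b = c := Option.mem_unique hb hc
    subst this
    exact ⟨b, hb, hA, hB⟩

theorem preim_univ (φ : α ≃. α) : φ.preim Set.univ = φ.dom := by
  ext a
  simp [preim, dom]

theorem preim_empty (φ : α ≃. α) : φ.preim ∅ = ∅ := by
  ext a
  simp [preim]

theorem preim_symm_preim (φ : α ≃. α) (A : Set α) :
    φ.preim (φ.symm.preim A) = φ.dom ∩ A := by
  ext a
  simp only [preim, dom, Set.mem_ofPred_eq, Set.mem_inter_iff]
  constructor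
  · rintro ⟨b, hb, c, hc, hA⟩
    have h1 : b ∈ φ c := φ.mem_iff_mem.1 hc
    have : a = c := φ.inj hb h1
    subst this
    exact ⟨⟨b, hb⟩, hA⟩
  · rintro ⟨⟨b, hb⟩, hA⟩
    exact ⟨b, hb, a, φ.mem_iff_mem.2 hb, hA⟩

theorem dom_trans_symm (φ : α ≃. α) : (φ.trans φ.symm).dom = φ.dom := by
  rw [dom_trans, ← preim_univ φ.symm, preim_symm_preim, Set.inter_univ]

theorem trans_symm_idem (φ : α ≃. α) :
    (φ.trans φ.symm).trans (φ.trans φ.symm) = φ.trans φ.symm := by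
  classical
  rw [φ.self_trans_symm]
  ext a : 1
  by_cases h : (φ a).isSome
  · simp [PEquiv.trans, PEquiv.ofSet, h]
  · simp [PEquiv.trans, PEquiv.ofSet, h]

end PEquiv

/-! ### Algebraic actions and their tight groupoids -/

/-- An algebraic action of a monoid `S`: an action on a group `G` by injective endomorphisms. -/
structure AlgebraicAction (S : Type v) (G : Type u) [Monoid S] [Group G] where
  /-- the homomorphism from `S` to the endomorphisms of `G` -/
  toEnd : S →* Monoid.End G
  injective : ∀ s : S, Function.Injective (toEnd s)

namespace AlgebraicAction

variable {S : Type v} {G : Type u} [Monoid S] [Group G]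

/-- The action is automorphic if every `s` acts by an automorphism. -/
def IsAutomorphic (σ : AlgebraicAction S G) : Prop :=
  ∀ s : S, Function.Bijective (σ.toEnd s)

/-- The endomorphism `σ_s` as a partial bijection of `G`. -/
noncomputable def endo (σ : AlgebraicAction S G) (s : S) : G ≃. G where
  toFun g := some (σ.toEnd s g)
  invFun := Function.partialInv (σ.toEnd s)
  inv a b := by
    rw [(σ.injective s).isPartialInv a b, Option.some_inj]

/-- The left translation by `g` as a partial bijection of `G`. -/
def translation (g : G) : G ≃. G := (Equiv.mulLeft g).toPEquiv

/-- The inverse semigroup `I` of partial bijections of `G` generated by the endomorphisms `σ_s`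
and the translations. -/
inductive InvSemigroup (σ : AlgebraicAction S G) : (G ≃. G) → Prop
  | endo (s : S) : InvSemigroup σ (σ.endo s)
  | translation (g : G) : InvSemigroup σ (translation g)
  | comp {φ ψ : G ≃. G} : InvSemigroup σ φ → InvSemigroup σ ψ → InvSemigroup σ (φ.trans ψ)
  | inverse {φ : G ≃. G} : InvSemigroup σ φ → InvSemigroup σ φ.symm

/-- The idempotent semilattice `E` of the inverse semigroup `I`. An idempotent partial bijection is
the identity map of its domain; it is identified with this domain. -/
def idempotentSets (σ : AlgebraicAction S G) : Set (Set G) :=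
  {A | ∃ φ : G ≃. G, σ.InvSemigroup φ ∧ φ.trans φ = φ ∧ φ.dom = A}

variable (σ : AlgebraicAction S G)

theorem invSemigroup_refl : σ.InvSemigroup (PEquiv.refl G) := by
  have h := InvSemigroup.translation (σ := σ) (1 : G)
  have h1 : (translation (1 : G)) = PEquiv.refl G := by
    ext a : 1
    simp [translation, Equiv.toPEquiv]
  rwa [h1] at h

theorem dom_mem {φ : G ≃. G} (hφ : σ.InvSemigroup φ) : φ.dom ∈ σ.idempotentSets :=
  ⟨φ.trans φ.symm, hφ.comp hφ.inverse, φ.trans_symm_idem, φ.dom_trans_symm⟩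

theorem univ_mem : Set.univ ∈ σ.idempotentSets := by
  rw [← PEquiv.dom_refl]
  exact σ.dom_mem σ.invSemigroup_refl

theorem preim_mem {φ : G ≃. G} (hφ : σ.InvSemigroup φ) {A : Set G}
    (hA : A ∈ σ.idempotentSets) : φ.preim A ∈ σ.idempotentSets := by
  obtain ⟨ψ, hψ, -, rfl⟩ := hA
  rw [← PEquiv.dom_trans]
  exact σ.dom_mem (hφ.comp hψ)

theorem inter_mem {A B : Set G} (hA : A ∈ σ.idempotentSets) (hB : B ∈ σ.idempotentSets) :
    A ∩ B ∈ σ.idempotentSets := by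
  obtain ⟨φ, hφ, -, rfl⟩ := hA
  rw [← PEquiv.preim_symm_preim]
  exact σ.preim_mem hφ (σ.preim_mem hφ.inverse hB)

/-- Characters of `E`: non-zero multiplicative maps `E → {0, 1}` that vanish at the empty set. The
product of two idempotents is the intersection of their domains. -/
def IsCharacter (χ : σ.idempotentSets → Bool) : Prop :=
  (∃ e, χ e = true) ∧
  (∀ e f : σ.idempotentSets, χ ⟨e.1 ∩ f.1, σ.inter_mem e.2 f.2⟩ = (χ e && χ f)) ∧
  (∀ h : ∅ ∈ σ.idempotentSets, χ ⟨∅, h⟩ = false)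

/-- The space of characters of `E`, with the topology of pointwise convergence. -/
abbrev Character : Type u := {χ : σ.idempotentSets → Bool // σ.IsCharacter χ}

variable {σ}

/-- The filter `{e ∈ E | χ(e) = 1}` of a character. -/
def Character.filter (χ : σ.Character) : Set σ.idempotentSets := {e | χ.1 e = true}

variable (σ)

/-- The characters whose filter is maximal with respect to inclusion. -/
def maximalCharacters : Set σ.Character :=
  {χ | ∀ χ' : σ.Character, χ.filter ⊆ χ'.filter → χ'.filter = χ.filter}

/-- The boundary `∂Ê` of the character space: the closure of the set of maximal characters. -/
def boundary : Set σ.Character := closure σ.maximalCharacters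

variable {σ}

theorem Character.inter (χ : σ.Character) {A B : Set G} (hA : A ∈ σ.idempotentSets)
    (hB : B ∈ σ.idempotentSets) (hAB : A ∩ B ∈ σ.idempotentSets) :
    χ.1 ⟨A ∩ B, hAB⟩ = (χ.1 ⟨A, hA⟩ && χ.1 ⟨B, hB⟩) :=
  χ.2.2.1 ⟨A, hA⟩ ⟨B, hB⟩

theorem Character.univ (χ : σ.Character) : χ.1 ⟨Set.univ, σ.univ_mem⟩ = true := by
  obtain ⟨⟨A, hA⟩, h⟩ := χ.2.1
  have h1 := χ.inter hA σ.univ_mem (by simpa using hA)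
  simp only [Set.inter_univ, h, Bool.true_and] at h1
  exact h1.symm

/-- The value of `φ.χ` at `A`, namely `χ(φ⁻¹ A φ)`, where the idempotent `φ⁻¹ A φ` has domain
`φ.preim A`. -/
def Character.actFun (χ : σ.Character) {φ : G ≃. G} (hφ : σ.InvSemigroup φ) :
    σ.idempotentSets → Bool :=
  fun A => χ.1 ⟨φ.preim A.1, σ.preim_mem hφ A.2⟩

/-- The character `φ.χ`, for `φ` in `I` and `χ` with `χ(dom φ) = 1`. -/
def Character.act (χ : σ.Character) {φ : G ≃. G} (hφ : σ.InvSemigroup φ)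
    (h : χ.1 ⟨φ.dom, σ.dom_mem hφ⟩ = true) : σ.Character :=
  ⟨χ.actFun hφ, ⟨⟨Set.univ, σ.univ_mem⟩, by simpa only [actFun, PEquiv.preim_univ] using h⟩,
    fun e f => by
      simp only [actFun, PEquiv.preim_inter]
      exact χ.inter _ _ _,
    fun h0 => by
      have h1 : (∅ : Set G) ∈ σ.idempotentSets := h0
      simpa only [actFun, PEquiv.preim_empty] using χ.2.2.2 h1⟩

/-- The pairs `(φ, χ)` with fixed source `χ`, where `φ` in `I` satisfies `χ(dom φ) = 1` and
`φ.χ = ω`. -/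
structure PreGerm (χ ω : σ.Character) : Type u where
  /-- the partial bijection -/
  map : G ≃. G
  mem : σ.InvSemigroup map
  dom : χ.1 ⟨map.dom, σ.dom_mem mem⟩ = true
  act_eq : χ.act mem dom = ω

/-- The equivalence relation that defines germs: `φ` and `ψ` have the same restriction to some
`e` in `E` with `χ(e) = 1` (such an `e` is not empty). -/
instance PreGerm.setoid (χ ω : σ.Character) : Setoid (PreGerm χ ω) where
  r p q := ∃ e : σ.idempotentSets, χ.1 e = true ∧ p.map.AgreeOn q.map e.1
  iseqv := {
    refl := fun _ => ⟨⟨Set.univ, σ.univ_mem⟩, χ.univ, fun _ _ => rfl⟩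
    symm := fun ⟨e, he, h⟩ => ⟨e, he, fun a ha => (h a ha).symm⟩
    trans := fun ⟨e, he, h⟩ ⟨f, hf, k⟩ =>
      ⟨⟨e.1 ∩ f.1, σ.inter_mem e.2 f.2⟩, by rw [χ.2.2.1, he, hf]; rfl,
        fun a ha => (h a ha.1).trans (k a ha.2)⟩ }

/-- The germs `[φ, χ]` with source `χ` and range `ω`. -/
abbrev Germ (χ ω : σ.Character) : Type u := Quotient (PreGerm.setoid χ ω)

theorem PreGerm.apply {χ ω : σ.Character} (p : PreGerm χ ω) (A : σ.idempotentSets) :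
    χ.1 ⟨p.map.preim A.1, σ.preim_mem p.mem A.2⟩ = ω.1 A :=
  congrArg (fun c : σ.Character => c.1 A) p.act_eq

/-- The unit `[id, χ]`. -/
def PreGerm.id (χ : σ.Character) : PreGerm χ χ where
  map := PEquiv.refl G
  mem := σ.invSemigroup_refl
  dom := by simpa only [PEquiv.dom_refl] using χ.univ
  act_eq := by
    apply Subtype.ext
    funext A
    simp only [Character.act, Character.actFun, PEquiv.preim_refl]

/-- The product `[ψ, φ.χ] [φ, χ] = [ψ φ, χ]`. -/
def PreGerm.comp {χ ω ρ : σ.Character} (p : PreGerm χ ω) (q : PreGerm ω ρ) : PreGerm χ ρ where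
  map := p.map.trans q.map
  mem := p.mem.comp q.mem
  dom := by
    simp only [PEquiv.dom_trans]
    exact (p.apply ⟨_, σ.dom_mem q.mem⟩).trans q.dom
  act_eq := by
    apply Subtype.ext
    funext A
    simp only [Character.act, Character.actFun, PEquiv.preim_trans]
    exact (p.apply ⟨_, σ.preim_mem q.mem A.2⟩).trans (q.apply A)

/-- The inverse `[φ, χ]⁻¹ = [φ⁻¹, φ.χ]`. -/
def PreGerm.inv {χ ω : σ.Character} (p : PreGerm χ ω) : PreGerm ω χ where
  map := p.map.symm
  mem := p.mem.inverse
  dom := by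
    rw [← p.apply]
    simp only [← PEquiv.dom_trans, PEquiv.dom_trans_symm]
    exact p.dom
  act_eq := by
    apply Subtype.ext
    funext A
    simp only [Character.act, Character.actFun]
    rw [← p.apply]
    simp only [PEquiv.preim_symm_preim]
    rw [χ.inter (σ.dom_mem p.mem) A.2, p.dom, Bool.true_and]

variable (σ) in
/-- The unit space `∂Ê` of the tight groupoid, with the subspace topology. -/
def TightGroupoid : Type u := σ.boundary

instance : TopologicalSpace σ.TightGroupoid :=
  inferInstanceAs (TopologicalSpace σ.boundary)

/-- The tight groupoid `I ⋉ ∂Ê`: its arrows are the germs with source and range in `∂Ê`. Note that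
`f ≫ g` is the product `g f` of germs. -/
instance : Groupoid.{u} σ.TightGroupoid where
  Hom χ ω := Germ χ.1 ω.1
  id χ := Quotient.mk _ (PreGerm.id χ.1)
  comp := Quotient.map₂ PreGerm.comp (by
    rintro p p' ⟨e, he, h⟩ q q' ⟨f, hf, k⟩
    refine ⟨⟨e.1 ∩ p.map.preim f.1, σ.inter_mem e.2 (σ.preim_mem p.mem f.2)⟩, ?_, ?_⟩
    · rw [Character.inter _ e.2 (σ.preim_mem p.mem f.2), he, p.apply f, hf]
      rfl
    · rintro a ⟨ha, b, hb, hbf⟩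
      have hb' : p.map a = some b := hb
      change (p.map a).bind q.map = (p'.map a).bind q'.map
      rw [← h a ha, hb']
      exact k b hbf)
  inv := Quotient.map PreGerm.inv (by
    rintro p q ⟨e, he, h⟩
    refine ⟨⟨p.map.symm.preim e.1, σ.preim_mem p.mem.inverse e.2⟩, ?_, ?_⟩
    · rw [← p.apply]
      simp only [PEquiv.preim_symm_preim]
      rw [Character.inter _ (σ.dom_mem p.mem) e.2, p.dom, he]
      rfl
    · rintro b ⟨a, ha, hae⟩
      have ha' : p.map.symm b = some a := ha
      have hb : p.map a = some b := (PEquiv.eq_some_iff _).1 ha'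
      rw [h a hae] at hb
      exact ha'.trans ((PEquiv.eq_some_iff _).2 hb).symm)
  id_comp := by
    rintro χ ω ⟨p⟩
    exact Quotient.sound ⟨⟨Set.univ, σ.univ_mem⟩, Character.univ _, fun _ _ => rfl⟩
  comp_id := by
    rintro χ ω ⟨p⟩
    refine Quotient.sound ⟨⟨Set.univ, σ.univ_mem⟩, Character.univ _, fun a _ => ?_⟩
    change (p.map.trans (PEquiv.refl G)) a = p.map a
    rw [PEquiv.trans_refl]
  assoc := by
    rintro χ ω ρ τ ⟨p⟩ ⟨q⟩ ⟨r⟩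
    refine Quotient.sound ⟨⟨Set.univ, σ.univ_mem⟩, Character.univ _, fun a _ => ?_⟩
    change ((p.map.trans q.map).trans r.map) a = (p.map.trans (q.map.trans r.map)) a
    rw [PEquiv.trans_assoc]
  inv_comp := by
    rintro χ ω ⟨p⟩
    refine Quotient.sound ⟨⟨p.map.symm.dom, σ.dom_mem p.mem.inverse⟩, p.inv.dom, ?_⟩
    rintro b ⟨a, ha⟩
    change (p.map.symm b).bind p.map = some b
    have ha' : p.map.symm b = some a := ha
    rw [ha']
    exact (PEquiv.eq_some_iff _).1 ha'
  comp_inv := by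
    rintro χ ω ⟨p⟩
    refine Quotient.sound ⟨⟨p.map.dom, σ.dom_mem p.mem⟩, p.dom, ?_⟩
    rintro a ⟨b, hb⟩
    change (p.map a).bind p.map.symm = some a
    have hb' : p.map a = some b := hb
    rw [hb']
    exact (PEquiv.eq_some_iff _).2 hb'

variable (σ) in
/-- The set `∂Ê(e; 𝔣)` of all `χ` in `∂Ê` with `χ(e) = 1` and `χ(f) = 0` for all `f` in `𝔣`. -/
def basicSet (e : σ.idempotentSets) (F : Finset σ.idempotentSets) : Set σ.TightGroupoid :=
  {χ | χ.1.1 e = true ∧ ∀ f ∈ F, χ.1.1 f = false}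

/-- The set `[φ, W]` of all germs `[φ, χ]` with `χ` in `W` (and `χ(dom φ) = 1`). -/
def germSet (φ : G ≃. G) (W : Set σ.TightGroupoid) : Set (Arrow σ.TightGroupoid) :=
  {a | a.left ∈ W ∧ ∃ p : PreGerm a.left.1 a.right.1, p.map = φ ∧ a.hom = Quotient.mk _ p}

/-- The topology of the tight groupoid, generated by the sets `[φ, ∂Ê(e; 𝔣)]` with `φ` in `I` and
`χ(dom φ) = 1` for all `χ` in `∂Ê(e; 𝔣)`. -/
instance : TopologicalSpace (Arrow σ.TightGroupoid) :=
  TopologicalSpace.generateFrom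
    {O | ∃ (φ : G ≃. G) (hφ : σ.InvSemigroup φ) (e : σ.idempotentSets)
        (F : Finset σ.idempotentSets),
      (∀ χ ∈ σ.basicSet e F, χ.1.1 ⟨φ.dom, σ.dom_mem hφ⟩ = true) ∧
      O = germSet φ (σ.basicSet e F)}

end AlgebraicAction

/-! Elements of `I` preserve the operation `x y⁻¹ z`, so every non-empty set in `E` is a coset of a
subgroup of `G`. A non-empty open set `X` of units contains `∂Ê(e)` for some non-empty `e` in `E`.
By minimality and compactness, finitely many sets `∂Ê(φ⁻¹(e))` cover the boundary; the sets `φ⁻¹(e)`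
then cover `G` itself, and B. H. Neumann's lemma makes one of them a coset `xH` with `[G : H]`
finite (`exists_finiteIndex_preim`).

Non-automorphy provides room inside `xH`. Take `σ_s` not surjective, `t = sⁿ` and `M = H ∩
σ_t⁻¹(H)`. Then `[G : M]` is finite, and `[H : σ_t(M)]` is either infinite or equal to `[G : M] [G :
σ_s(G)]ⁿ / [G : H]`, which is at least `2 [G : M]` for large `n`. Hence each coset of `M` in `G` can
be embedded twice into `xH`, and from there into `e` by `φ`, with all images disjoint
(`exists_separated_family`, `exists_partition`). A boundary character cannot vanish on a whole
finite cover of `G` (`exists_eq_true_of_cover`), so the germs of these maps over `X` form two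
compact open bisections with source `X` and disjoint ranges inside `∂Ê(e)`. -/

namespace PEquiv

/-! ### Affine partial bijections; sets in `E` as cosets -/

/-- A partial bijection of a group is affine if it preserves the operation `x y⁻¹ z`. -/
def IsAffine {α : Type u} [Group α] (φ : α ≃. α) : Prop :=
  ∀ ⦃x y z x' y' z' : α⦄, x' ∈ φ x → y' ∈ φ y → z' ∈ φ z → x' * y'⁻¹ * z' ∈ φ (x * y⁻¹ * z)

end PEquiv

namespace AlgebraicAction

variable {S : Type v} {G : Type u} [Monoid S] [Group G] {σ : AlgebraicAction S G}

theorem mem_endo {s : S} {a b : G} : b ∈ σ.endo s a ↔ σ.toEnd s a = b := by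
  simp [endo]

theorem mem_translation {g a b : G} : b ∈ translation g a ↔ g * a = b := by
  simp [translation, Equiv.toPEquiv]

theorem InvSemigroup.isAffine {φ : G ≃. G} (hφ : σ.InvSemigroup φ) : φ.IsAffine := by
  induction hφ with
  | endo s =>
    intro x y z x' y' z' hx hy hz
    rw [mem_endo] at *
    rw [← hx, ← hy, ← hz, map_mul, map_mul, map_inv]
  | translation g =>
    intro x y z x' y' z' hx hy hz
    rw [mem_translation] at *
    rw [← hx, ← hy, ← hz]
    group
  | comp _ _ h k =>
    intro x y z x' y' z' hx hy hz
    rw [PEquiv.mem_trans] at *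
    obtain ⟨a, ha, hx⟩ := hx
    obtain ⟨b, hb, hy⟩ := hy
    obtain ⟨c, hc, hz⟩ := hz
    exact ⟨_, h ha hb hc, k hx hy hz⟩
  | inverse _ h =>
    intro x y z x' y' z' hx hy hz
    rw [PEquiv.mem_iff_mem] at *
    exact h hx hy hz

/-- A non-empty subset of a group closed under `x y⁻¹ z` is a coset of a subgroup; this is the only
structural fact about `E` that the coset arguments need. -/
theorem mul_inv_mul_mem {A : Set G} (hA : A ∈ σ.idempotentSets) {x y z : G} (hx : x ∈ A)
    (hy : y ∈ A) (hz : z ∈ A) : x * y⁻¹ * z ∈ A := by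
  obtain ⟨φ, hφ, -, rfl⟩ := hA
  obtain ⟨x', hx⟩ := hx
  obtain ⟨y', hy⟩ := hy
  obtain ⟨z', hz⟩ := hz
  exact ⟨_, hφ.isAffine hx hy hz⟩

theorem translate_mem {A : Set G} (hA : A ∈ σ.idempotentSets) (g : G) :
    {y | g * y ∈ A} ∈ σ.idempotentSets := by
  have h := σ.preim_mem (.translation g) hA
  convert h using 1
  ext y
  simp only [PEquiv.preim, Set.mem_ofPred_eq, mem_translation, exists_eq_left']

theorem comap_endo_mem {A : Set G} (hA : A ∈ σ.idempotentSets) (s : S) :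
    {y | σ.toEnd s y ∈ A} ∈ σ.idempotentSets := by
  have h := σ.preim_mem (.endo s) hA
  convert h using 1
  ext y
  simp only [PEquiv.preim, Set.mem_ofPred_eq, mem_endo, exists_eq_left']

theorem biInter_mem {ι : Type*} (t : Finset ι) (A : ι → Set G)
    (hA : ∀ i ∈ t, A i ∈ σ.idempotentSets) : (⋂ i ∈ t, A i) ∈ σ.idempotentSets := by
  classical
  induction t using Finset.induction_on with
  | empty => simpa using σ.univ_mem
  | insert i t _ ih =>
    rw [Finset.set_biInter_insert]
    exact σ.inter_mem (hA i (Finset.mem_insert_self i t))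
      (ih fun j hj => hA j (Finset.mem_insert_of_mem hj))

/-- The subgroup `x⁻¹ A`, for a set `A` in `E` that contains `x`. -/
def cosetSubgroup {A : Set G} (hA : A ∈ σ.idempotentSets) {x : G} (hx : x ∈ A) : Subgroup G where
  carrier := {y | x * y ∈ A}
  one_mem' := by simpa using hx
  mul_mem' {a b} ha hb := by
    have h := mul_inv_mul_mem hA ha hx hb
    simpa [mul_assoc] using h
  inv_mem' {a} ha := by
    have h := mul_inv_mul_mem hA hx ha hx
    simpa [mul_assoc] using h

theorem mem_cosetSubgroup {A : Set G} {hA : A ∈ σ.idempotentSets} {x : G} {hx : x ∈ A} {y : G} :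
    y ∈ cosetSubgroup hA hx ↔ x * y ∈ A := Iff.rfl

/-- A finite cover of `G` by sets in `E` contains a coset of a subgroup of finite index. -/
theorem exists_finiteIndex_of_cover {ι : Type*} (t : Finset ι) (A : ι → Set G)
    (hA : ∀ i, A i ∈ σ.idempotentSets) (x : ι → G) (hx : ∀ i, x i ∈ A i)
    (hcover : ∀ g, ∃ i ∈ t, g ∈ A i) : ∃ i, (cosetSubgroup (hA i) (hx i)).FiniteIndex := by
  -- B. H. Neumann's lemma, applied to `A i` as the left coset of `cosetSubgroup` through `x i`.
  have h := Subgroup.exists_finiteIndex_of_leftCoset_cover (s := t) (g := x)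
    (H := fun i => cosetSubgroup (hA i) (hx i)) (by
      rw [Set.eq_univ_iff_forall]
      intro g
      obtain ⟨i, hi, hg⟩ := hcover g
      simp only [Set.mem_iUnion]
      refine ⟨i, hi, ?_⟩
      rw [Set.mem_smul_set_iff_inv_smul_mem]
      simpa [mem_cosetSubgroup] using hg)
  obtain ⟨i, -, hi⟩ := h
  exact ⟨i, hi⟩

/-! ### Index computation and the doubling partition of `G` -/

/-- The endomorphism `σ_s` as a group homomorphism. -/
def endHom (σ : AlgebraicAction S G) (s : S) : G →* G := σ.toEnd s

theorem endHom_injective (s : S) : Function.Injective (σ.endHom s) := σ.injective s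

theorem endHom_mul (s t : S) : σ.endHom (s * t) = (σ.endHom s).comp (σ.endHom t) :=
  map_mul σ.toEnd s t

theorem endHom_one : σ.endHom 1 = MonoidHom.id G := map_one σ.toEnd

theorem index_range_endHom_pow (s : S) (n : ℕ) :
    (σ.endHom (s ^ n)).range.index = (σ.endHom s).range.index ^ n := by
  induction n with
  | zero => rw [pow_zero, endHom_one, MonoidHom.range_eq_top.2 Function.surjective_id]; simp
  | succ n ih =>
    rw [pow_succ', endHom_mul, MonoidHom.range_comp,
      Subgroup.index_map_of_injective _ (endHom_injective s), ih, pow_succ]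

/-- Infinite index is encoded as `0`, so the conclusion covers that case too. -/
theorem exists_index_ne_one (hσ : ¬ σ.IsAutomorphic) : ∃ s, (σ.endHom s).range.index ≠ 1 := by
  by_contra! h
  refine hσ fun s => ⟨σ.injective s, ?_⟩
  exact MonoidHom.range_eq_top.1 (Subgroup.index_eq_one.1 (h s))

/-- For a subgroup `H` of finite index there are `t` and a subgroup `M` of finite index in `H` such
that `H` contains at least `2 [G : M]` cosets of `σ_t(M)`. -/
theorem exists_separated_family (hσ : ¬ σ.IsAutomorphic) (H : Subgroup G) [H.FiniteIndex] :
    ∃ (t : S) (M : Subgroup G), M = H ⊓ H.comap (σ.endHom t) ∧ M.FiniteIndex ∧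
      ∃ h : (G ⧸ M) × Bool → G, (∀ i, h i ∈ H) ∧
        ∀ i j, (h i)⁻¹ * h j ∈ M.map (σ.endHom t) → i = j := by
  obtain ⟨s, hs⟩ := exists_index_ne_one hσ
  -- For any `k ≥ 2` one has `kⁿ ≥ n`, so this exponent pays for both the factor `2` and the
  -- division by `[G : H]`.
  set n := 2 * H.index with hn
  set M := H ⊓ H.comap (σ.endHom (s ^ n)) with hM
  set K := M.map (σ.endHom (s ^ n)) with hK
  have hKH : K ≤ H := by
    rw [hK, Subgroup.map_le_iff_le_comap]
    exact inf_le_right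
  have hcomap : (H.comap (σ.endHom (s ^ n))).FiniteIndex := by
    refine ⟨?_⟩
    rw [Subgroup.index_comap]
    exact (Subgroup.isFiniteRelIndex_of_finiteIndex (H := H)).relIndex_ne_zero
  have hMf : M.FiniteIndex := inferInstance
  have hH0 : H.index ≠ 0 := Subgroup.FiniteIndex.index_ne_zero
  -- It suffices to embed the finite set `(G ⧸ M) × Bool` into the cosets of `K` in `H`. This is
  -- immediate if there are infinitely many; otherwise it is a count.
  have hemb : Nonempty ((G ⧸ M) × Bool ↪ H ⧸ K.subgroupOf H) := by
    by_cases hfin : Finite (H ⧸ K.subgroupOf H)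
    · have h0 : K.relIndex H ≠ 0 := by
        rw [Subgroup.relIndex, Subgroup.index_ne_zero_iff_finite]
        exact hfin
      -- Both sides equal `[G : K]`, computed through `H` and through the image of `σ_{sⁿ}`.
      have h1 : K.relIndex H * H.index = M.index * (σ.endHom s).range.index ^ n := by
        rw [Subgroup.relIndex_mul_index hKH, hK,
          Subgroup.index_map_of_injective _ (endHom_injective (s ^ n)), index_range_endHom_pow]
      have hk0 : (σ.endHom s).range.index ≠ 0 := by
        intro hk
        have : n ≠ 0 := by omega
        rw [hk, zero_pow this, mul_zero] at h1
        exact mul_ne_zero h0 hH0 h1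
      have h2 : n ≤ (σ.endHom s).range.index ^ n :=
        (Nat.lt_pow_self (by omega)).le
      have h3 : M.index * 2 ≤ K.relIndex H := by
        refine Nat.le_of_mul_le_mul_right ?_ (Nat.pos_of_ne_zero hH0)
        rw [h1, mul_assoc]
        exact Nat.mul_le_mul_left _ h2
      have := Fintype.ofFinite (G ⧸ M)
      have := Fintype.ofFinite (H ⧸ K.subgroupOf H)
      refine Function.Embedding.nonempty_of_card_le ?_
      rw [Fintype.card_prod, Fintype.card_bool, ← Nat.card_eq_fintype_card,
        ← Nat.card_eq_fintype_card]
      exact h3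
    · rw [not_finite_iff_infinite] at hfin
      have : Finite (G ⧸ M) := inferInstance
      obtain ⟨k, ⟨e⟩⟩ := Finite.exists_equiv_fin ((G ⧸ M) × Bool)
      exact ⟨(e.toEmbedding.trans Fin.valEmbedding).trans (Infinite.natEmbedding _)⟩
  obtain ⟨ε⟩ := hemb
  refine ⟨s ^ n, M, rfl, hMf, fun i => ((ε i).out : H), fun i => ((ε i).out : H).2, fun i j hij => ?_⟩
  apply ε.injective
  rw [← (ε i).out_eq', ← (ε j).out_eq']
  exact QuotientGroup.eq.2 (Subgroup.mem_subgroupOf.2 hij)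

/-- If the set `φ⁻¹(e)` is a coset of a subgroup of finite index, then `G` has a finite partition
whose members are mapped into `e` by two elements of `I` each, with disjoint images. -/
theorem exists_partition (hσ : ¬ σ.IsAutomorphic) {φ : G ≃. G} (hφ : σ.InvSemigroup φ)
    {e : Set G} (he : e ∈ σ.idempotentSets) {x : G} (hx : x ∈ φ.preim e)
    (hfin : (cosetSubgroup (σ.preim_mem hφ he) hx).FiniteIndex) :
    ∃ (ι : Type u) (_ : Finite ι) (P : ι → σ.idempotentSets) (θ : ι × Bool → G ≃. G),
      (∀ i, σ.InvSemigroup (θ i)) ∧ (∀ g, ∃ i, g ∈ (P i).1) ∧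
      (∀ i j, ((P i).1 ∩ (P j).1).Nonempty → i = j) ∧
      (∀ i, (P i.1).1 ⊆ (θ i).preim e) ∧
      ∀ i j a b c, a ∈ (P i.1).1 → b ∈ (P j.1).1 → c ∈ θ i a → c ∈ θ j b → i = j := by
  set H := cosetSubgroup (σ.preim_mem hφ he) hx with hH
  obtain ⟨t, M, hM, hMf, h, hmem, hsep⟩ := exists_separated_family hσ H
  have hHE : {y | y ∈ H} ∈ σ.idempotentSets := translate_mem (σ.preim_mem hφ he) x
  have hPE (q : G ⧸ M) : {y : G | q.out⁻¹ * y ∈ M} ∈ σ.idempotentSets :=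
    translate_mem (A := {y | y ∈ M}) (hM ▸ σ.inter_mem hHE (comap_endo_mem hHE t)) _
  have hP (q : G ⧸ M) (y : G) : q.out⁻¹ * y ∈ M ↔ q = y := by
    rw [← QuotientGroup.eq, QuotientGroup.out_eq']
  -- With `q` the chosen representative of the coset `i.1`, the map sends `q m` to `φ(x h_i
  -- σ_t(m))`. For `m` in `M` the argument of `φ` lies in `x h_i σ_t(M) ⊆ xH`, and the cosets `h_i
  -- σ_t(M)` are pairwise disjoint.
  have hθ (i : (G ⧸ M) × Bool) {a b : G} :
      b ∈ ((translation i.1.out⁻¹).trans ((σ.endo t).trans ((translation (x * h i)).trans φ))) a ↔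
        b ∈ φ (x * h i * σ.endHom t (i.1.out⁻¹ * a)) := by
    simp only [PEquiv.mem_trans, mem_translation, mem_endo]
    constructor
    · rintro ⟨_, rfl, _, rfl, _, rfl, h⟩
      exact h
    · exact fun h => ⟨_, rfl, _, rfl, _, rfl, h⟩
  refine ⟨G ⧸ M, inferInstance, fun q => ⟨_, hPE q⟩, fun i => (translation i.1.out⁻¹).trans
    ((σ.endo t).trans ((translation (x * h i)).trans φ)), fun i => ?_, fun g => ⟨g, ?_⟩, ?_, ?_, ?_⟩
  · exact .comp (.translation _) (.comp (.endo _) (.comp (.translation _) hφ))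
  · exact (hP _ _).2 rfl
  · rintro i j ⟨g, hi, hj⟩
    rw [(hP i g).1 hi, (hP j g).1 hj]
  · intro i a ha
    have h1 : x * (h i * σ.endHom t (i.1.out⁻¹ * a)) ∈ φ.preim e := H.mul_mem (hmem i) (hM.le ha).2
    rw [← mul_assoc] at h1
    obtain ⟨b, hb, hbe⟩ := h1
    exact ⟨b, (hθ i).2 hb, hbe⟩
  · intro i j a b c ha hb hca hcb
    have h1 := φ.inj ((hθ i).1 hca) ((hθ j).1 hcb)
    rw [mul_assoc, mul_assoc, mul_left_cancel_iff] at h1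
    apply hsep
    refine ⟨(i.1.out⁻¹ * a) * (j.1.out⁻¹ * b)⁻¹, M.mul_mem ha (M.inv_mem hb), ?_⟩
    rw [map_mul, map_inv, mul_inv_eq_iff_eq_mul, mul_assoc, ← h1, inv_mul_cancel_left]

/-! ### Characters as filters; maximal characters -/

theorem Character.inter_eq_true (χ : σ.Character) {e f : σ.idempotentSets} (he : χ.1 e = true)
    (hf : χ.1 f = true) : χ.1 ⟨e.1 ∩ f.1, σ.inter_mem e.2 f.2⟩ = true := by
  rw [χ.2.2.1, he, hf]
  rfl

theorem Character.nonempty (χ : σ.Character) {e : σ.idempotentSets} (he : χ.1 e = true) :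
    e.1.Nonempty := by
  rw [Set.nonempty_iff_ne_empty]
  obtain ⟨e, h⟩ := e
  rintro rfl
  rw [χ.2.2.2 h] at he
  exact Bool.false_ne_true he

theorem Character.mono (χ : σ.Character) {e f : σ.idempotentSets} (hef : e.1 ⊆ f.1)
    (he : χ.1 e = true) : χ.1 f = true := by
  have h := χ.2.2.1 e f
  have h1 : (⟨e.1 ∩ f.1, σ.inter_mem e.2 f.2⟩ : σ.idempotentSets) = e :=
    Subtype.ext (Set.inter_eq_left.2 hef)
  rwa [h1, he, Bool.true_and, eq_comm] at h

theorem Character.filter_injective {χ χ' : σ.Character} (h : χ.filter = χ'.filter) : χ = χ' := by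
  apply Subtype.ext
  funext e
  exact Bool.eq_iff_iff.2 (Set.ext_iff.1 h e)

variable (σ) in
/-- The proper filters of `E`. -/
def properFilters : Set (Set σ.idempotentSets) :=
  {F | (∀ e ∈ F, ∀ f ∈ F, ⟨e.1 ∩ f.1, σ.inter_mem e.2 f.2⟩ ∈ F) ∧
    (∀ e ∈ F, ∀ f : σ.idempotentSets, e.1 ⊆ f.1 → f ∈ F) ∧ ∀ e ∈ F, e.1.Nonempty}

theorem Character.filter_mem (χ : σ.Character) : χ.filter ∈ σ.properFilters :=
  ⟨fun _ he _ hf => χ.inter_eq_true he hf, fun _ he _ hef => χ.mono hef he,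
    fun _ he => χ.nonempty he⟩

/-- The empty family belongs to `properFilters` but gives the zero map, hence the condition `hne`.
-/
theorem exists_filter_eq {F : Set σ.idempotentSets} (hF : F ∈ σ.properFilters)
    (hne : F.Nonempty) : ∃ χ : σ.Character, χ.filter = F := by
  classical
  refine ⟨⟨fun e => decide (e ∈ F), ?_, fun e f => ?_, fun h => ?_⟩, ?_⟩
  · obtain ⟨e, he⟩ := hne
    exact ⟨e, decide_eq_true he⟩
  · rw [Bool.eq_iff_iff]
    simp only [decide_eq_true_eq, Bool.and_eq_true]
    exact ⟨fun h => ⟨hF.2.1 _ h _ Set.inter_subset_left, hF.2.1 _ h _ Set.inter_subset_right⟩,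
      fun h => hF.1 _ h.1 _ h.2⟩
  · exact decide_eq_false fun h0 => (hF.2.2 _ h0).ne_empty rfl
  · ext e
    simp [Character.filter]

/-- Every filter base of non-empty sets in `E` is contained in the filter of a maximal character. -/
theorem exists_maximal_filter_superset (T : Set σ.idempotentSets) (hne : T.Nonempty)
    (hT : ∀ e ∈ T, ∀ f ∈ T, ∃ g ∈ T, g.1 ⊆ e.1 ∩ f.1) (hT0 : ∀ e ∈ T, e.1.Nonempty) :
    ∃ χ ∈ σ.maximalCharacters, T ⊆ χ.filter := by
  -- Zorn's lemma above the upward closure of `T`, which is a proper filter because `T` is a base of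
  -- non-empty sets.
  obtain ⟨F, hTF, hF⟩ := zorn_subset_nonempty σ.properFilters (by
    intro c hc hchain hcne
    refine ⟨⋃₀ c, ⟨?_, ?_, ?_⟩, fun s hs => Set.subset_sUnion_of_mem hs⟩
    · rintro e ⟨A, hA, heA⟩ f ⟨B, hB, hfB⟩
      rcases hchain.total hA hB with h | h
      · exact ⟨B, hB, (hc hB).1 _ (h heA) _ hfB⟩
      · exact ⟨A, hA, (hc hA).1 _ heA _ (h hfB)⟩
    · rintro e ⟨A, hA, heA⟩ f hef
      exact ⟨A, hA, (hc hA).2.1 _ heA _ hef⟩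
    · rintro e ⟨A, hA, heA⟩
      exact (hc hA).2.2 _ heA) {e | ∃ f ∈ T, f.1 ⊆ e.1} (by
    refine ⟨?_, ?_, ?_⟩
    · rintro e ⟨e', he', hee⟩ f ⟨f', hf', hff⟩
      obtain ⟨g, hg, hgi⟩ := hT e' he' f' hf'
      exact ⟨g, hg, hgi.trans (Set.inter_subset_inter hee hff)⟩
    · rintro e ⟨e', he', hee⟩ f hef
      exact ⟨e', he', hee.trans hef⟩
    · rintro e ⟨e', he', hee⟩
      exact (hT0 e' he').mono hee)
  have hTF' : T ⊆ F := fun e he => hTF ⟨e, he, subset_rfl⟩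
  obtain ⟨χ, hχ⟩ := exists_filter_eq hF.prop (hne.mono hTF')
  refine ⟨χ, fun χ' h => ?_, hχ ▸ hTF'⟩
  rw [hχ] at h ⊢
  exact (hF.eq_of_subset χ'.filter_mem h).symm

theorem exists_maximal_of_nonempty {e : σ.idempotentSets} (he : e.1.Nonempty) :
    ∃ χ ∈ σ.maximalCharacters, χ.1 e = true := by
  obtain ⟨χ, hχ, h⟩ := exists_maximal_filter_superset {e} (Set.singleton_nonempty e)
    (by rintro _ rfl _ rfl; exact ⟨_, rfl, (Set.inter_self _).ge⟩) (by rintro _ rfl; exact he)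
  exact ⟨χ, hχ, h rfl⟩

/-- If a maximal character vanishes at `f`, then its filter has a member disjoint from `f`. -/
theorem exists_disjoint_of_eq_false {χ : σ.Character} (hχ : χ ∈ σ.maximalCharacters)
    {f : σ.idempotentSets} (hf : ¬ χ.1 f = true) : ∃ e, χ.1 e = true ∧ Disjoint e.1 f.1 := by
  -- Otherwise the traces `e ∩ f` form a base of non-empty sets, and a filter above it contains both
  -- `χ.filter` and `f`, against maximality.
  by_contra! h
  obtain ⟨χ', -, hT⟩ := exists_maximal_filter_superset
    ((fun e : σ.idempotentSets => (⟨e.1 ∩ f.1, σ.inter_mem e.2 f.2⟩ : σ.idempotentSets)) ''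
      χ.filter) (Set.Nonempty.image _ χ.2.1) (by
        rintro _ ⟨a, ha, rfl⟩ _ ⟨b, hb, rfl⟩
        refine ⟨_, ⟨_, χ.inter_eq_true ha hb, rfl⟩, ?_⟩
        rintro x ⟨⟨hxa, hxb⟩, hxf⟩
        exact ⟨⟨hxa, hxf⟩, hxb, hxf⟩) (by
        rintro _ ⟨a, ha, rfl⟩
        exact Set.not_disjoint_iff_nonempty_inter.1 (h a ha))
  have h1 (e : σ.idempotentSets) (he : e ∈ χ.filter) : χ'.1 e = true ∧ χ'.1 f = true :=
    have := hT ⟨e, he, rfl⟩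
    ⟨χ'.mono Set.inter_subset_left this, χ'.mono Set.inter_subset_right this⟩
  have h2 : χ'.filter = χ.filter := hχ χ' fun e he => (h1 e he).1
  obtain ⟨e, he⟩ := χ.2.1
  have h3 : f ∈ χ'.filter := (h1 e he).2
  rw [h2] at h3
  exact hf h3

theorem Character.isClopen (e : σ.idempotentSets) : IsClopen {χ : σ.Character | χ.1 e = true} :=
  (isClopen_discrete {true}).preimage ((continuous_apply e).comp continuous_subtype_val)

theorem Character.biInter_eq_true (χ : σ.Character) {ι : Type*} (t : Finset ι) (A : ι → Set G)
    (hA : ∀ i ∈ t, ∃ h, χ.1 ⟨A i, h⟩ = true) : ∃ h, χ.1 ⟨⋂ i ∈ t, A i, h⟩ = true := by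
  classical
  induction t using Finset.induction_on with
  | empty => exact ⟨by simpa using σ.univ_mem, by simpa using χ.univ⟩
  | insert i t _ ih =>
    obtain ⟨h1, h2⟩ := hA i (Finset.mem_insert_self i t)
    obtain ⟨h3, h4⟩ := ih fun j hj => hA j (Finset.mem_insert_of_mem hj)
    simp only [Finset.set_biInter_insert]
    exact ⟨σ.inter_mem h1 h3, χ.inter_eq_true h2 h4⟩

/-- A character in the boundary does not vanish on all members of a finite cover of `G`. -/
theorem exists_eq_true_of_cover {χ : σ.Character} (hχ : χ ∈ σ.boundary) {ι : Type*} [Finite ι]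
    (P : ι → σ.idempotentSets) (hP : ∀ g, ∃ i, g ∈ (P i).1) : ∃ i, χ.1 (P i) = true := by
  have := Fintype.ofFinite ι
  -- The condition is closed because the cover is finite, so it need only be checked on maximal
  -- characters. There, vanishing on every `P i` would yield a non-empty set disjoint from all of
  -- them.
  have hclosed : IsClosed {χ : σ.Character | ∃ i, χ.1 (P i) = true} := by
    rw [Set.ofPred_exists]
    exact isClosed_iUnion_of_finite fun i => (Character.isClopen (P i)).1
  refine closure_minimal (fun χ hχ => ?_) hclosed hχ
  by_contra h0
  have h (i : ι) : ¬ χ.1 (P i) = true := fun hi => h0 ⟨i, hi⟩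
  choose e he hdisj using fun i => exists_disjoint_of_eq_false hχ (h i)
  obtain ⟨h1, h2⟩ := χ.biInter_eq_true Finset.univ (fun i => (e i).1) fun i _ => ⟨_, he i⟩
  obtain ⟨g, hg⟩ := χ.nonempty h2
  obtain ⟨i, hi⟩ := hP g
  exact Set.disjoint_left.1 (hdisj i) (Set.mem_iInter₂.1 hg i (Finset.mem_univ i)) hi

/-- A finite family of non-empty sets in `E` that meets the filters of all maximal characters
covers `G`. -/
theorem cover_of_maximal {ι : Type*} (t : Finset ι) (A : ι → Set G)
    (hA : ∀ i, A i ∈ σ.idempotentSets) (x : ι → G) (hx : ∀ i, x i ∈ A i)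
    (h : ∀ χ ∈ σ.maximalCharacters, ∃ i ∈ t, χ.1 ⟨A i, hA i⟩ = true) (g : G) :
    ∃ i ∈ t, g ∈ A i := by
  -- With `A i = x_i H_i`, this set is the intersection of the cosets `g H_i`, which contains `g`. A
  -- maximal character supported on it takes the value one at some `A i`; then `x_i H_i` meets `g
  -- H_i`, so the two cosets agree and `g ∈ A i`.
  have hmem : (⋂ i ∈ t, {y | x i * g⁻¹ * y ∈ A i}) ∈ σ.idempotentSets :=
    biInter_mem t _ fun i _ => translate_mem (hA i) _
  obtain ⟨χ, hχ, hχe⟩ := exists_maximal_of_nonempty (e := ⟨_, hmem⟩)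
    ⟨g, Set.mem_iInter₂.2 fun i _ => by simpa using hx i⟩
  obtain ⟨i, hi, hχi⟩ := h χ hχ
  obtain ⟨z, hz, hzi⟩ := χ.nonempty (χ.inter_eq_true hχe hχi)
  refine ⟨i, hi, ?_⟩
  have h1 := mul_inv_mul_mem (hA i) hzi (Set.mem_iInter₂.1 hz i hi) (hx i)
  simpa [mul_assoc] using h1

/-! ### Compactness, and invariance of the boundary -/

instance : CompactSpace σ.Character := by
  suffices h0 : IsClosed {χ : σ.idempotentSets → Bool | σ.IsCharacter χ} from
    isCompact_iff_compactSpace.1 h0.isCompact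
  -- Being non-zero is not visibly a closed condition; for multiplicative maps it amounts to the
  -- value one at `G`, which is.
  have h : {χ : σ.idempotentSets → Bool | σ.IsCharacter χ} =
      {χ | χ ⟨Set.univ, σ.univ_mem⟩ = true} ∩
      ({χ | ∀ e f : σ.idempotentSets, χ ⟨e.1 ∩ f.1, σ.inter_mem e.2 f.2⟩ = (χ e && χ f)} ∩
      {χ | ∀ h : ∅ ∈ σ.idempotentSets, χ ⟨∅, h⟩ = false}) := by
    ext χ
    exact ⟨fun h => ⟨Character.univ ⟨χ, h⟩, h.2⟩, fun h => ⟨⟨_, h.1⟩, h.2⟩⟩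
  rw [h]
  refine (isClosed_eq (continuous_apply _) continuous_const).inter (IsClosed.inter ?_ ?_)
  · simp only [Set.ofPred_forall]
    refine isClosed_iInter fun e => isClosed_iInter fun f => isClosed_eq (continuous_apply _) ?_
    have hand : Continuous fun p : Bool × Bool => p.1 && p.2 := continuous_of_discreteTopology
    exact hand.comp (f := fun χ : σ.idempotentSets → Bool => (χ e, χ f))
      ((continuous_apply e).prodMk (continuous_apply f))
  · simp only [Set.ofPred_forall]
    exact isClosed_iInter fun h => isClosed_eq (continuous_apply _) continuous_const

theorem Character.continuous_act {φ : G ≃. G} (hφ : σ.InvSemigroup φ) :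
    Continuous fun χ : {χ : σ.Character | χ.1 ⟨φ.dom, σ.dom_mem hφ⟩ = true} =>
      χ.1.act hφ χ.2 :=
  Continuous.subtype_mk (continuous_pi fun A => (continuous_apply
    (⟨φ.preim A.1, σ.preim_mem hφ A.2⟩ : σ.idempotentSets)).comp
      (continuous_subtype_val.comp continuous_subtype_val)) _

theorem Character.symm_dom_act (χ : σ.Character) {φ : G ≃. G} (hφ : σ.InvSemigroup φ)
    (h : χ.1 ⟨φ.dom, σ.dom_mem hφ⟩ = true) :
    (χ.act hφ h).1 ⟨φ.symm.dom, σ.dom_mem hφ.inverse⟩ = true :=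
  (PreGerm.inv ⟨φ, hφ, h, rfl⟩ : PreGerm (χ.act hφ h) χ).dom

theorem Character.act_act_symm (χ : σ.Character) {φ : G ≃. G} (hφ : σ.InvSemigroup φ)
    (h : χ.1 ⟨φ.dom, σ.dom_mem hφ⟩ = true) :
    (χ.act hφ h).act hφ.inverse (χ.symm_dom_act hφ h) = χ :=
  (PreGerm.inv ⟨φ, hφ, h, rfl⟩ : PreGerm (χ.act hφ h) χ).act_eq

theorem Character.act_mem_maximalCharacters {χ : σ.Character} (hχ : χ ∈ σ.maximalCharacters)
    {φ : G ≃. G} (hφ : σ.InvSemigroup φ) (h : χ.1 ⟨φ.dom, σ.dom_mem hφ⟩ = true) :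
    χ.act hφ h ∈ σ.maximalCharacters := by
  intro ω hω
  have hdom : ω.1 ⟨φ.symm.dom, σ.dom_mem hφ.inverse⟩ = true := hω (χ.symm_dom_act hφ h)
  -- A larger filter at `φ.χ` is pulled back by `φ⁻¹` to a filter above that of `χ`, where
  -- maximality applies.
  have h1 : ω.act hφ.inverse hdom = χ := by
    refine Character.filter_injective (hχ _ fun e he => hω ?_)
    have h2 := χ.act_act_symm hφ h
    change ((χ.act hφ h).act hφ.inverse (χ.symm_dom_act hφ h)).1 e = true
    rw [h2]
    exact he
  subst h1
  rw [show (ω.act hφ.inverse hdom).act hφ h = ω from ω.act_act_symm hφ.inverse hdom]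

theorem Character.act_mem_boundary {χ : σ.Character} (hχ : χ ∈ σ.boundary)
    {φ : G ≃. G} (hφ : σ.InvSemigroup φ) (h : χ.1 ⟨φ.dom, σ.dom_mem hφ⟩ = true) :
    χ.act hφ h ∈ σ.boundary := by
  -- The domain of the action is open, so `χ` is a limit of maximal characters inside it, and the
  -- continuous action keeps those maximal.
  have h1 := (Character.isClopen (σ := σ) ⟨φ.dom, σ.dom_mem hφ⟩).2.isOpenMap_subtype_val
    |>.preimage_closure_subset_closure_preimage (s := σ.maximalCharacters)
      (show (⟨χ, h⟩ : {χ : σ.Character | χ.1 ⟨φ.dom, σ.dom_mem hφ⟩ = true}) ∈ _ from hχ)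
  exact map_mem_closure (Character.continuous_act hφ) h1
    fun ω hω => act_mem_maximalCharacters hω hφ ω.2

instance : CompactSpace σ.TightGroupoid :=
  isCompact_iff_compactSpace.1 (isClosed_closure (s := σ.maximalCharacters)).isCompact

theorem TightGroupoid.isInducing :
    Topology.IsInducing fun χ : σ.TightGroupoid => (χ.1.1 : σ.idempotentSets → Bool) :=
  Topology.IsInducing.subtypeVal.comp Topology.IsInducing.subtypeVal

theorem TightGroupoid.isClopen (e : σ.idempotentSets) :
    IsClopen {χ : σ.TightGroupoid | χ.1.1 e = true} :=
  (isClopen_discrete {true}).preimage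
    ((continuous_apply e).comp TightGroupoid.isInducing.continuous)

/-- The sets `∂Ê(e; 𝔣)` form a base of the topology of the boundary. -/
theorem exists_basicSet_subset {W : Set σ.TightGroupoid} (hW : IsOpen W) {χ : σ.TightGroupoid}
    (hχ : χ ∈ W) : ∃ e F, χ ∈ σ.basicSet e F ∧ σ.basicSet e F ⊆ W := by
  classical
  obtain ⟨O, hO, rfl⟩ := TightGroupoid.isInducing.isOpen_iff.1 hW
  obtain ⟨I, u, hu, hIsub⟩ := isOpen_pi_iff.1 hO _ hχ
  -- A basic neighbourhood fixes finitely many values of `χ`. The sets with value one are merged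
  -- into their intersection `e`; those with value zero form `𝔣`.
  obtain ⟨h1, h2⟩ := χ.1.biInter_eq_true {f ∈ I | χ.1.1 f = true} (fun f => f.1)
    fun f hf => ⟨f.2, (Finset.mem_filter.1 hf).2⟩
  refine ⟨⟨_, h1⟩, {f ∈ I | χ.1.1 f = false},
    ⟨h2, fun f hf => (Finset.mem_filter.1 hf).2⟩, fun ω hω => hIsub fun f hf => ?_⟩
  have h3 : ω.1.1 f = χ.1.1 f := by
    cases hf' : χ.1.1 f with
    | true =>
      exact ω.1.mono (Set.biInter_subset_of_mem (Finset.mem_filter.2 ⟨hf, hf'⟩)) hω.1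
    | false => exact hω.2 f (Finset.mem_filter.2 ⟨hf, hf'⟩)
  change ω.1.1 f ∈ u f
  rw [h3]
  exact (hu f hf).2

/-! ### Germs: open and compact sets of arrows -/

/-- The arrow `[φ, χ]` of the tight groupoid. -/
def germArrow {φ : G ≃. G} (hφ : σ.InvSemigroup φ) (χ : σ.TightGroupoid)
    (h : χ.1.1 ⟨φ.dom, σ.dom_mem hφ⟩ = true) : Arrow σ.TightGroupoid where
  left := χ
  right := ⟨χ.1.act hφ h, Character.act_mem_boundary χ.2 hφ h⟩
  hom := Quotient.mk _ (⟨φ, hφ, h, rfl⟩ : PreGerm χ.1 (χ.1.act hφ h))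

theorem mem_germSet {φ : G ≃. G} (hφ : σ.InvSemigroup φ) {W : Set σ.TightGroupoid}
    {a : Arrow σ.TightGroupoid} : a ∈ germSet φ W ↔ ∃ χ ∈ W, ∃ h, a = germArrow hφ χ h := by
  constructor
  · obtain ⟨χ, ⟨ω, hω⟩, f⟩ := a
    rintro ⟨hχ, ⟨ψ, hψ, hd, hact⟩, rfl, hf⟩
    refine ⟨χ, hχ, hd, ?_⟩
    change χ.1.1 ⟨ψ.dom, _⟩ = true at hd
    change χ.1.act hψ hd = ω at hact
    change f = _ at hf
    subst hact
    exact congrArg (Arrow.mk (T := σ.TightGroupoid) (X := χ) (Y := ⟨_, hω⟩)) hf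
  · rintro ⟨χ, hχ, h, rfl⟩
    exact ⟨hχ, ⟨φ, hφ, h, rfl⟩, rfl, rfl⟩

theorem Character.act_eq_of_agreeOn (χ : σ.Character) {φ ψ : G ≃. G} (hφ : σ.InvSemigroup φ)
    (hψ : σ.InvSemigroup ψ) (h : χ.1 ⟨φ.dom, σ.dom_mem hφ⟩ = true)
    (k : χ.1 ⟨ψ.dom, σ.dom_mem hψ⟩ = true) {e : σ.idempotentSets} (he : χ.1 e = true)
    (hagree : φ.AgreeOn ψ e.1) : χ.act hφ h = χ.act hψ k := by
  apply Character.filter_injective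
  ext A
  change χ.1 _ = true ↔ χ.1 _ = true
  constructor
  · intro hA
    refine χ.mono ?_ (χ.inter_eq_true hA he)
    rintro a ⟨⟨b, hb, hbA⟩, ha⟩
    exact ⟨b, by rwa [← hagree a ha], hbA⟩
  · intro hA
    refine χ.mono ?_ (χ.inter_eq_true hA he)
    rintro a ⟨⟨b, hb, hbA⟩, ha⟩
    exact ⟨b, by rwa [hagree a ha], hbA⟩

theorem germArrow_mem_germSet {φ ψ : G ≃. G} (hφ : σ.InvSemigroup φ) (hψ : σ.InvSemigroup ψ)
    (χ : σ.TightGroupoid) (h : χ.1.1 ⟨φ.dom, σ.dom_mem hφ⟩ = true) {W : Set σ.TightGroupoid}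
    (hW : ∀ ω ∈ W, ω.1.1 ⟨ψ.dom, σ.dom_mem hψ⟩ = true) :
    germArrow hφ χ h ∈ germSet ψ W ↔
      χ ∈ W ∧ ∃ e : σ.idempotentSets, χ.1.1 e = true ∧ φ.AgreeOn ψ e.1 := by
  constructor
  · rintro ⟨hχ, p, rfl, hp⟩
    exact ⟨hχ, Quotient.exact hp⟩
  · rintro ⟨hχ, e, he, hagree⟩
    exact ⟨hχ, ⟨ψ, hψ, hW χ hχ, (χ.1.act_eq_of_agreeOn hφ hψ h _ he hagree).symm⟩, rfl,
      Quotient.sound ⟨e, he, hagree⟩⟩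

theorem continuous_germArrow {φ : G ≃. G} (hφ : σ.InvSemigroup φ) :
    Continuous fun χ : {χ : σ.TightGroupoid | χ.1.1 ⟨φ.dom, σ.dom_mem hφ⟩ = true} =>
      germArrow hφ χ.1 χ.2 := by
  refine continuous_generateFrom_iff.2 ?_
  rintro _ ⟨ψ, hψ, e, F, hW, rfl⟩
  refine isOpen_iff_forall_mem_open.2 fun χ hχ => ?_
  obtain ⟨hχW, d, hd, hagree⟩ := (germArrow_mem_germSet hφ hψ χ.1 χ.2 hW).1 hχ
  -- The set `d` that witnesses equality of the two germs at `χ` does so at every `ω` with `ω(d) =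
  -- 1`, an open condition.
  refine ⟨Subtype.val ⁻¹' ({ω | ω.1.1 d = true} ∩ σ.basicSet e F), fun ω hω =>
    (germArrow_mem_germSet hφ hψ ω.1 ω.2 hW).2 ⟨hω.2, d, hω.1, hagree⟩, ?_, hd, hχW⟩
  refine ((TightGroupoid.isClopen d).2.inter ?_).preimage continuous_subtype_val
  have h : σ.basicSet e F = {ω | ω.1.1 e = true} ∩ ⋂ f ∈ F, {ω | ω.1.1 f = true}ᶜ := by
    ext ω
    simp [basicSet]
  rw [h]
  exact (TightGroupoid.isClopen e).2.inter
    (isOpen_biInter_finset fun f _ => (TightGroupoid.isClopen f).compl.2)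

theorem isOpen_germSet {φ : G ≃. G} (hφ : σ.InvSemigroup φ) {W : Set σ.TightGroupoid}
    (hW : IsOpen W) (hdom : ∀ χ ∈ W, χ.1.1 ⟨φ.dom, σ.dom_mem hφ⟩ = true) :
    IsOpen (germSet φ W) := by
  refine isOpen_iff_forall_mem_open.2 fun a ha => ?_
  obtain ⟨e, F, haB, hBW⟩ := exists_basicSet_subset hW ha.1
  exact ⟨germSet φ (σ.basicSet e F), fun b hb => ⟨hBW hb.1, hb.2⟩,
    TopologicalSpace.isOpen_generateFrom_of_mem
      ⟨φ, hφ, e, F, fun χ hχ => hdom χ (hBW hχ), rfl⟩, haB, ha.2⟩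

theorem isCompact_germSet {φ : G ≃. G} (hφ : σ.InvSemigroup φ) {W : Set σ.TightGroupoid}
    (hW : IsCompact W) (hdom : ∀ χ ∈ W, χ.1.1 ⟨φ.dom, σ.dom_mem hφ⟩ = true) :
    IsCompact (germSet φ W) := by
  have h : germSet φ W =
      (fun χ : {χ : σ.TightGroupoid | χ.1.1 ⟨φ.dom, σ.dom_mem hφ⟩ = true} =>
        germArrow hφ χ.1 χ.2) '' (Subtype.val ⁻¹' W) := by
    ext a
    rw [mem_germSet hφ]
    constructor
    · rintro ⟨χ, hχ, h, rfl⟩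
      exact ⟨⟨χ, h⟩, hχ, rfl⟩
    · rintro ⟨χ, hχ, rfl⟩
      exact ⟨χ.1, hχ, χ.2, rfl⟩
  rw [h]
  refine IsCompact.image ?_ (continuous_germArrow hφ)
  refine Topology.IsInducing.subtypeVal.isCompact_preimage_iff ?_ |>.2 hW
  rintro χ hχ
  exact ⟨⟨χ, hdom χ hχ⟩, rfl⟩

/-! ### Minimality and small open sets -/

/-- If the tight groupoid is minimal, then every non-empty set `e` in `E` has a preimage under an
element of `I` that is a coset of a subgroup of finite index. -/
theorem exists_finiteIndex_preim (hmin : GroupoidDynamics.IsMinimal σ.TightGroupoid)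
    {e : Set G} (he : e ∈ σ.idempotentSets) (hne : e.Nonempty) :
    ∃ (φ : G ≃. G) (hφ : σ.InvSemigroup φ) (x : G) (hx : x ∈ φ.preim e),
      (cosetSubgroup (σ.preim_mem hφ he) hx).FiniteIndex := by
  have hopen := (TightGroupoid.isClopen (σ := σ) ⟨e, he⟩).2
  obtain ⟨χ₀, hχ₀, hχ₀e⟩ := exists_maximal_of_nonempty (e := ⟨e, he⟩) hne
  have h (χ : σ.TightGroupoid) : ∃ (φ : G ≃. G) (hφ : σ.InvSemigroup φ),
      χ.1.1 ⟨φ.preim e, σ.preim_mem hφ he⟩ = true := by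
    obtain ⟨ω, hω, ⟨f⟩⟩ := (hmin χ).inter_open_nonempty _ hopen
      ⟨⟨χ₀, subset_closure hχ₀⟩, hχ₀e⟩
    obtain ⟨p, -⟩ := Quotient.exists_rep f
    exact ⟨p.map, p.mem, (p.apply ⟨e, he⟩).trans hω⟩
  choose φ hφ hχφ using h
  -- Every orbit meets `∂Ê(e)`, so the open sets `∂Ê(φ⁻¹(e))` cover the compact unit space.
  obtain ⟨t, ht⟩ := CompactSpace.elim_nhds_subcover
    (fun χ => {ω : σ.TightGroupoid | ω.1.1 ⟨(φ χ).preim e, σ.preim_mem (hφ χ) he⟩ = true})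
    fun χ => (TightGroupoid.isClopen _).2.mem_nhds (hχφ χ)
  choose x hx using fun χ : σ.TightGroupoid => χ.1.nonempty (hχφ χ)
  obtain ⟨χ, hχ⟩ := exists_finiteIndex_of_cover t (fun χ => (φ χ).preim e)
    (fun χ => σ.preim_mem (hφ χ) he) x hx (cover_of_maximal t _ _ x hx fun χ hχ => by
      have h1 : (⟨χ, subset_closure hχ⟩ : σ.TightGroupoid) ∈ (⊤ : Set σ.TightGroupoid) := trivial
      rw [← ht] at h1
      obtain ⟨ω, hω, h2⟩ := Set.mem_iUnion₂.1 h1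
      exact ⟨ω, hω, h2⟩)
  exact ⟨φ χ, hφ χ, x χ, hx χ, hχ⟩

/-- Every non-empty open subset of the boundary contains `∂Ê(e)` for a non-empty set `e` in `E`. -/
theorem exists_nonempty_subset {X : Set σ.TightGroupoid} (hX : IsOpen X) (hne : X.Nonempty) :
    ∃ e : σ.idempotentSets, e.1.Nonempty ∧ {χ : σ.TightGroupoid | χ.1.1 e = true} ⊆ X := by
  obtain ⟨O, hO, rfl⟩ := isOpen_induced_iff.1 hX
  obtain ⟨χ, hχ⟩ := hne
  obtain ⟨μ, hμO, hμ⟩ := mem_closure_iff.1 χ.2 O hO hχ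
  have hμne : Nonempty μ.filter := ⟨_, μ.2.1.choose_spec⟩
  -- The closed sets given by the members of `μ.filter` are directed, and by maximality they
  -- intersect in `μ` alone. Compactness puts one of them inside `O`, so no vanishing conditions are
  -- needed.
  obtain ⟨e, he⟩ := exists_subset_nhds_of_compactSpace
    (V := fun e : μ.filter => {ω : σ.Character | ω.1 e.1 = true})
    (fun e f => ⟨⟨_, μ.inter_eq_true e.2 f.2⟩, fun ω hω => ω.mono Set.inter_subset_left hω,
      fun ω hω => ω.mono Set.inter_subset_right hω⟩)
    (fun e => (Character.isClopen e.1).1) (U := O) (fun ω hω => by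
      have h : ω.filter = μ.filter := hμ ω fun e he => Set.mem_iInter.1 hω ⟨e, he⟩
      rw [Character.filter_injective h]
      exact hO.mem_nhds hμO)
  exact ⟨e.1, μ.nonempty e.2, fun ω hω => he hω⟩

/-! ### Bisections from finite families of partial bijections -/

/-- Evaluating `φ.χ` at images under `φ` recovers `χ`; this makes the range map injective on germs
of a fixed `φ` and turns disjointness of images in `G` into disjointness of ranges. -/
theorem germArrow_right_apply_symm_preim (χ : σ.TightGroupoid) {φ : G ≃. G} (hφ : σ.InvSemigroup φ)
    (h : χ.1.1 ⟨φ.dom, σ.dom_mem hφ⟩ = true) (A : σ.idempotentSets) :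
    (germArrow hφ χ h).right.1.1 ⟨φ.symm.preim A.1, σ.preim_mem hφ.inverse A.2⟩ = χ.1.1 A :=
  (PreGerm.inv ⟨φ, hφ, h, rfl⟩ : PreGerm (χ.1.act hφ h) χ.1).apply A

theorem germArrow_right_injective {φ : G ≃. G} {hφ hφ' : σ.InvSemigroup φ}
    {χ ω : σ.TightGroupoid} {h : χ.1.1 ⟨φ.dom, σ.dom_mem hφ⟩ = true}
    {k : ω.1.1 ⟨φ.dom, σ.dom_mem hφ'⟩ = true}
    (heq : (germArrow hφ χ h).right = (germArrow hφ' ω k).right) : χ = ω := by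
  apply Subtype.ext
  apply Subtype.ext
  funext A
  rw [← germArrow_right_apply_symm_preim χ hφ h, ← germArrow_right_apply_symm_preim ω hφ' k, heq]

/-- If two arrows `[φ, χ]` and `[ψ, ω]` have the same range, then the images under `φ` and `ψ` of
sets in the filters of `χ` and `ω` intersect. -/
theorem exists_common_image {φ ψ : G ≃. G} {hφ : σ.InvSemigroup φ} {hψ : σ.InvSemigroup ψ}
    {χ ω : σ.TightGroupoid} {h : χ.1.1 ⟨φ.dom, σ.dom_mem hφ⟩ = true}
    {k : ω.1.1 ⟨ψ.dom, σ.dom_mem hψ⟩ = true}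
    (heq : (germArrow hφ χ h).right = (germArrow hψ ω k).right) {P Q : σ.idempotentSets}
    (hP : χ.1.1 P = true) (hQ : ω.1.1 Q = true) :
    ∃ a b c, a ∈ P.1 ∧ b ∈ Q.1 ∧ c ∈ φ a ∧ c ∈ ψ b := by
  have h1 := (germArrow_right_apply_symm_preim χ hφ h P).trans hP
  have h2 := (germArrow_right_apply_symm_preim ω hψ k Q).trans hQ
  rw [← heq] at h2
  obtain ⟨c, ⟨a, ha, haP⟩, b, hb, hbQ⟩ := Character.nonempty _ (Character.inter_eq_true _ h1 h2)
  exact ⟨a, b, c, haP, hbQ, φ.mem_iff_mem.1 ha, ψ.mem_iff_mem.1 hb⟩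

/-- A finite family of elements of `I` with disjoint sources that cover `X`, and with disjoint
ranges, defines a compact open bisection. -/
theorem isCompactOpenBisection_iUnion {X : Set σ.TightGroupoid} (hXc : IsCompact X)
    (hXo : IsOpen X) {ι : Type*} [Finite ι] (P : ι → σ.idempotentSets) (θ : ι → G ≃. G)
    (hθ : ∀ i, σ.InvSemigroup (θ i)) (hdisj : ∀ i j, ((P i).1 ∩ (P j).1).Nonempty → i = j)
    (hdom : ∀ i, (P i).1 ⊆ (θ i).dom)
    (hran : ∀ i j a b c, a ∈ (P i).1 → b ∈ (P j).1 → c ∈ θ i a → c ∈ θ j b → i = j) :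
    GroupoidDynamics.IsCompactOpenBisection
      (⋃ i, germSet (θ i) (X ∩ {χ | χ.1.1 (P i) = true})) := by
  refine ⟨isCompact_iUnion fun i => isCompact_germSet (hθ i)
    (hXc.inter_right (TightGroupoid.isClopen _).1) fun χ hχ => χ.1.mono (hdom i) hχ.2,
    isOpen_iUnion fun i => isOpen_germSet (hθ i)
    (hXo.inter (TightGroupoid.isClopen _).2) fun χ hχ => χ.1.mono (hdom i) hχ.2, ?_, ?_⟩
  · intro a ha b hb hab
    obtain ⟨i, hi⟩ := Set.mem_iUnion.1 ha
    obtain ⟨j, hj⟩ := Set.mem_iUnion.1 hb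
    obtain ⟨χ, hχ, h, rfl⟩ := (mem_germSet (hθ i)).1 hi
    obtain ⟨ω, hω, k, rfl⟩ := (mem_germSet (hθ j)).1 hj
    obtain rfl : χ = ω := hab
    -- Sets in the filter of one character always meet, so disjoint pieces of `G` give disjoint
    -- sources.
    obtain rfl : i = j := hdisj i j (χ.1.nonempty (χ.1.inter_eq_true hχ.2 hω.2))
    rfl
  · intro a ha b hb hab
    obtain ⟨i, hi⟩ := Set.mem_iUnion.1 ha
    obtain ⟨j, hj⟩ := Set.mem_iUnion.1 hb
    obtain ⟨χ, hχ, h, rfl⟩ := (mem_germSet (hθ i)).1 hi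
    obtain ⟨ω, hω, k, rfl⟩ := (mem_germSet (hθ j)).1 hj
    obtain ⟨a, b, c, h1, h2, h3, h4⟩ := exists_common_image hab hχ.2 hω.2
    obtain rfl : i = j := hran i j a b c h1 h2 h3 h4
    obtain rfl : χ = ω := germArrow_right_injective hab
    rfl

theorem sourceSet_iUnion_germSet {X : Set σ.TightGroupoid} {ι : Type*} [Finite ι]
    (P : ι → σ.idempotentSets) (θ : ι → G ≃. G) (hθ : ∀ i, σ.InvSemigroup (θ i))
    (hcover : ∀ g, ∃ i, g ∈ (P i).1) (hdom : ∀ i, (P i).1 ⊆ (θ i).dom) :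
    GroupoidDynamics.sourceSet (⋃ i, germSet (θ i) (X ∩ {χ | χ.1.1 (P i) = true})) = X := by
  ext χ
  constructor
  · rintro ⟨a, ha, rfl⟩
    obtain ⟨i, hi⟩ := Set.mem_iUnion.1 ha
    exact hi.1.1
  · intro hχ
    obtain ⟨i, hi⟩ := exists_eq_true_of_cover χ.2 P hcover
    exact ⟨germArrow (hθ i) χ (χ.1.mono (hdom i) hi), Set.mem_iUnion.2
      ⟨i, (mem_germSet (hθ i)).2 ⟨χ, ⟨hχ, hi⟩, _, rfl⟩⟩, rfl⟩

theorem rangeSet_iUnion_germSet_subset {X Y : Set σ.TightGroupoid} {e : Set G}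
    (he : e ∈ σ.idempotentSets) (hY : {χ : σ.TightGroupoid | χ.1.1 ⟨e, he⟩ = true} ⊆ Y)
    {ι : Type*} (P : ι → σ.idempotentSets) (θ : ι → G ≃. G) (hθ : ∀ i, σ.InvSemigroup (θ i))
    (hpre : ∀ i, (P i).1 ⊆ (θ i).preim e) :
    GroupoidDynamics.rangeSet (⋃ i, germSet (θ i) (X ∩ {χ | χ.1.1 (P i) = true})) ⊆ Y := by
  rintro _ ⟨a, ha, rfl⟩
  obtain ⟨i, hi⟩ := Set.mem_iUnion.1 ha
  obtain ⟨χ, hχ, h, rfl⟩ := (mem_germSet (hθ i)).1 hi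
  exact hY (χ.1.mono (f := ⟨_, σ.preim_mem (hθ i) he⟩) (hpre i) hχ.2)

end AlgebraicAction

/-! ### Pure infiniteness -/

theorem mainTheorem1 {S : Type v} {G : Type u} [Monoid S] [Group G]
    (σ : AlgebraicAction S G) (hσ : ¬ σ.IsAutomorphic)
    (hmin : GroupoidDynamics.IsMinimal σ.TightGroupoid) :
    GroupoidDynamics.IsPurelyInfinite σ.TightGroupoid := by
  intro X hXc hXo
  rcases X.eq_empty_or_nonempty with rfl | hne
  · refine ⟨∅, ∅, ?_, ?_, ?_⟩
    iterate 2 exact ⟨isCompact_empty, isOpen_empty, Set.injOn_empty _, Set.injOn_empty _⟩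
    simp [GroupoidDynamics.sourceSet, GroupoidDynamics.rangeSet]
  obtain ⟨⟨e, he⟩, hene, heX⟩ := AlgebraicAction.exists_nonempty_subset hXo hne
  obtain ⟨φ, hφ, x, hx, hfin⟩ := AlgebraicAction.exists_finiteIndex_preim hmin he hene
  obtain ⟨ι, _, P, θ, hθ, hcover, hdisj, hpre, hran⟩ :=
    AlgebraicAction.exists_partition hσ hφ he hx hfin
  have hdom (i : ι × Bool) : (P i.1).1 ⊆ (θ i).dom := fun a ha => by
    obtain ⟨b, hb, -⟩ := hpre i ha
    exact ⟨b, hb⟩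
  -- The two values of `β` select the two copies of the partition, one for each bisection.
  have hbis (β : Bool) := AlgebraicAction.isCompactOpenBisection_iUnion hXc hXo P
    (fun i => θ (i, β)) (fun i => hθ (i, β)) hdisj (fun i => hdom (i, β))
    fun i j a b c ha hb hca hcb => congrArg Prod.fst (hran (i, β) (j, β) a b c ha hb hca hcb)
  have hsource (β : Bool) := AlgebraicAction.sourceSet_iUnion_germSet (X := X) P
    (fun i => θ (i, β)) (fun i => hθ (i, β)) hcover fun i => hdom (i, β)
  have hrange (β : Bool) := AlgebraicAction.rangeSet_iUnion_germSet_subset (X := X) he heX P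
    (fun i => θ (i, β)) (fun i => hθ (i, β)) fun i => hpre (i, β)
  refine ⟨_, _, hbis false, hbis true, hsource false, hsource true, ?_, hrange false,
    hrange true⟩
  rw [Set.disjoint_left]
  rintro _ ⟨a, ha, rfl⟩ ⟨b, hb, hab⟩
  obtain ⟨i, hi⟩ := Set.mem_iUnion.1 ha
  obtain ⟨j, hj⟩ := Set.mem_iUnion.1 hb
  obtain ⟨χ, hχ, h, rfl⟩ := (AlgebraicAction.mem_germSet (hθ (i, false))).1 hi
  obtain ⟨ω, hω, k, rfl⟩ := (AlgebraicAction.mem_germSet (hθ (j, true))).1 hj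
  -- A common range point would give a common image point of two maps from different copies.
  obtain ⟨a, b, c, h1, h2, h3, h4⟩ := AlgebraicAction.exists_common_image hab hω.2 hχ.2
  exact Bool.false_ne_true (congrArg Prod.snd (hran (j, true) (i, false) a b c h1 h2 h3 h4)).symm
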